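/- Let $R$ be an integral domain (commutative, with $1 \neq 0$, not assumed Noetherian), let $\mathcal{S}(R)$ be the set of all ideals of $R$, including $0$ and $R$, and let $\overline{\mathbb{N}} = \{0,1,2,\dots\} \cup \{\infty\}$. For a commutative ring $A$, a finite sequence $a_1,\dots,a_r$ $(r \ge 0)$ of elements of $A$ is a weak $A$-sequence if, for each $i = 1, \dots, r$, $a_i$ is not a zerodivisor on the $A$-module $A/(a_1,\dots,a_{i-1})$ (that is, multiplication by $a_i$ is injective on it; the module may be zero). The grade $\operatorname{grade}_A(\mathfrak a) \in \overline{\mathbb{N}}$ of an ideal $\mathfrak a$ of $A$ is the supremum of the lengths of the weak $A$-sequences all of whose terms lie in $\mathfrak a$. For $I \in \mathcal{S}(R)$ the polynomial grade of $I$ is \[ \operatorname{p.grade}(I) = \lim_{m\to\infty} \operatorname{grade}_{R[X_1,\dots,X_m]}\bigl(I[X_1,\dots,X_m]\bigr), \] where $I[X_1,\dots,X_m]$ is the extension of $I$ to $R[X_1,\dots,X_m]$. Then this limit exists in $\overline{\mathbb{N}}$ for every $I \in \mathcal{S}(R)$, and $\operatorname{p.grade} \colon \mathcal{S}(R) \to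 \overline{\mathbb{N}}$ is an ideal valuation on $R$; that is: 1. $\operatorname{p.grade}(0) = 0$ and $\operatorname{p.grade}(R) = \infty$; 2. $\min\{\operatorname{p.grade}(I), \operatorname{p.grade}(J)\} \le \operatorname{p.grade}(IJ)$ for all $I, J \in \mathcal{S}(R)$; 3. $\operatorname{p.grade}(I) = \sup\{\operatorname{p.grade}(J) \mid J \subseteq I,\ J \text{ a finitely generated ideal of } R\}$ for every $I \in \mathcal{S}(R)$. -/

import Mathlib

open Filter Topology

noncomputable section

/-- The classical grade of an ideal `I` of `R`: the supremum in `ℕ∞` of the lengths of the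
weak `R`-sequences whose terms all lie in `I`. -/
def classicalGrade {R : Type*} [CommRing R] (I : Ideal R) : ℕ∞ :=
  sSup {n : ℕ∞ | ∃ a : List R, (∀ x ∈ a, x ∈ I) ∧
    RingTheory.Sequence.IsWeaklyRegular R a ∧ n = (a.length : ℕ∞)}

/-- The grade of the extension `I[X₁, …, Xₘ]` of `I` to the polynomial ring `R[X₁, …, Xₘ]`. -/
def gradeInVariables {R : Type*} [CommRing R] (I : Ideal R) (m : ℕ) : ℕ∞ :=
  classicalGrade (I.map (MvPolynomial.C : R →+* MvPolynomial (Fin m) R))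

/-- The polynomial grade of `I`: the limit, as `m → ∞`, of the grades of `I[X₁, …, Xₘ]`.
The topology on `ℕ∞` is the order topology. -/
def polynomialGrade {R : Type*} [CommRing R] (I : Ideal R) : ℕ∞ :=
  limUnder atTop (fun m : ℕ => gradeInVariables I m)

/-- Ideal valuations on a domain `R`. -/
structure IsIdealValuation {R : Type*} [CommRing R] [IsDomain R] (ν : Ideal R → ℕ∞) : Prop where
  map_bot : ν ⊥ = 0
  map_top : ν ⊤ = ⊤
  min_le_map_mul : ∀ I J : Ideal R, min (ν I) (ν J) ≤ ν (I * J)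
  eq_sSup_fg : ∀ I : Ideal R, ν I = sSup {n : ℕ∞ | ∃ J : Ideal R, J ≤ I ∧ J.FG ∧ n = ν J}

end

/-! The grades increase with `m` by flatness, so the limit is a supremum, and a weakly regular
sequence involves only finitely many coefficients, which gives property 3. The core is property 2.
Let `fs` generate `L` and be shorter than weakly regular sequences in `I` and in `J`. Vanishing of
`Ext` gives `L : I = L = L : J` (`mem_ofList_of_forall_mul_mem_ofList`), hence `L : IJ = L`. By
McCoy, a polynomial whose coefficients generate a suitable finitely generated subideal of `IJ` is a
nonzerodivisor modulo `L[X]`. Thus each new variable lengthens a sequence in the extension of `IJ`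
by one (`exists_isWeaklyRegular_append_polynomial`). -/

section ExtVanishing

open CategoryTheory Abelian Limits Pointwise RingTheory.Sequence ModuleCat

universe u

variable {R : Type u} [CommRing R]

/-- If the annihilator of `N` contains a weakly `M`-regular sequence of length `n`, then
`Ext N M i` vanishes for `i < n`. -/
lemma subsingleton_ext_of_isWeaklyRegular (N M : ModuleCat.{u} R) (rs : List R)
    (mem : ∀ r ∈ rs, r ∈ Module.annihilator R N) (reg : IsWeaklyRegular M rs) :
    ∀ i < rs.length, Subsingleton (Ext N M i) := by
  induction rs generalizing M with
  | nil => simp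
  | cons a rs ih =>
    intro i hi
    simp only [isWeaklyRegular_cons_iff] at reg
    simp only [List.mem_cons, forall_eq_or_imp] at mem
    match i with
    | 0 =>
      have : Subsingleton (N →ₗ[R] M) := reg.1.linearMap_subsingleton_of_mem_annihilator mem.1
      exact (Ext.addEquiv₀.trans ModuleCat.homAddEquiv).subsingleton
    | i + 1 =>
      -- Multiplication by `a` on `Ext N M (i + 1)` is injective, as `Ext N (M/aM) i` vanishes, and
      -- it is zero, as `a` kills `N`.
      let g := (AddCommGrpCat.ofHom ((Ext.mk₀ (smulShortComplex M a).f).postcomp N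
        (add_zero (i + 1))))
      have mono_g : Mono g := by
        apply (Ext.covariant_sequence_exact₁' N reg.1.smulShortComplex_shortExact i (i + 1)
          rfl).mono_g ((AddCommGrpCat.isZero_of_iff_subsingleton.mpr ?_).eq_zero_of_src _)
        exact ih (ModuleCat.of R (QuotSMulTop a M)) mem.2 reg.2 i (by simpa using hi)
      have zero_g : g = 0 := Ext.postcomp_smul_id_eq_zero_of_mem_annihilator mem.1 (i + 1)
      exact AddCommGrpCat.subsingleton_of_isZero (IsZero.of_mono_eq_zero _ zero_g)

/-- If `Ext N M i` vanishes for `i ≤ n` and `rs` is a weakly `M`-regular sequence of length at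
most `n`, then there is no nonzero homomorphism from `N` to `M ⧸ (rs) M`. -/
lemma subsingleton_linearMap_quotient_of_subsingleton_ext (N M : ModuleCat.{u} R) (rs : List R)
    (reg : IsWeaklyRegular M rs) (h : ∀ i ≤ rs.length, Subsingleton (Ext N M i)) :
    Subsingleton (N →ₗ[R] (M ⧸ (Ideal.ofList rs • ⊤ : Submodule R M))) := by
  induction rs generalizing M with
  | nil =>
    have : Subsingleton (Ext N M 0) := h 0 le_rfl
    have : Subsingleton (N →ₗ[R] M) :=
      (Ext.addEquiv₀.trans ModuleCat.homAddEquiv).symm.subsingleton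
    exact (LinearEquiv.congrRight (Submodule.quotEquivOfEqBot _ (by simp))).subsingleton
  | cons a rs ih =>
    simp only [isWeaklyRegular_cons_iff] at reg
    -- `Ext N (M/aM) i` sits between `Ext N M i` and `Ext N M (i + 1)`, which costs one degree per
    -- term.
    have := ih (ModuleCat.of R (QuotSMulTop a M)) reg.2 fun i hi ↦ by
      have zero1 := AddCommGrpCat.isZero_of_iff_subsingleton.mpr (h i (by simp; omega))
      have zero2 := AddCommGrpCat.isZero_of_iff_subsingleton.mpr (h (i + 1) (by simpa using hi))
      exact AddCommGrpCat.subsingleton_of_isZero <| ShortComplex.Exact.isZero_of_both_zeros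
        ((Ext.covariant_sequence_exact₃' N reg.1.smulShortComplex_shortExact) i (i + 1) rfl)
        (zero1.eq_zero_of_src _) (zero2.eq_zero_of_tgt _)
    exact (LinearEquiv.congrRight
      (Submodule.quotOfListConsSMulTopEquivQuotSMulTopInner M a rs)).subsingleton

/-- A weakly regular sequence that is shorter than some weakly regular sequence in `I` generates
an ideal `L` with `L : I = L`. -/
lemma mem_ofList_of_forall_mul_mem_ofList {I : Ideal R} {as fs : List R}
    (has : ∀ a ∈ as, a ∈ I) (ras : IsWeaklyRegular R as) (rfs : IsWeaklyRegular R fs)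
    (hlen : fs.length < as.length) {s : R} (hs : ∀ y ∈ I, y * s ∈ Ideal.ofList fs) :
    s ∈ Ideal.ofList fs := by
  have hsub := subsingleton_linearMap_quotient_of_subsingleton_ext (ModuleCat.of R (R ⧸ I))
    (ModuleCat.of R R) fs rfs fun i hi ↦
      subsingleton_ext_of_isWeaklyRegular _ _ as
        (fun r hr ↦ by simpa [Ideal.annihilator_quotient] using has r hr) ras i (by omega)
  have htop : (Ideal.ofList fs • ⊤ : Submodule R R) = Ideal.ofList fs := by simp
  -- An `s` with `I s ⊆ L` is the image of `1` under a homomorphism from `R/I` to `R/L`.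
  let φ : (R ⧸ I) →ₗ[R] R ⧸ (Ideal.ofList fs • ⊤ : Submodule R R) :=
    Submodule.liftQ I (LinearMap.toSpanSingleton R _ (Submodule.Quotient.mk s)) fun y hy ↦ by
      rw [LinearMap.mem_ker, LinearMap.toSpanSingleton_apply, ← Submodule.Quotient.mk_smul,
        Submodule.Quotient.mk_eq_zero, htop]
      exact hs y hy
  have h0 : φ (Submodule.Quotient.mk 1) = 0 := by
    rw [show φ = 0 from hsub.elim _ _, LinearMap.zero_apply]
  rw [Submodule.liftQ_apply, LinearMap.toSpanSingleton_apply, one_smul,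
    Submodule.Quotient.mk_eq_zero, htop] at h0
  exact h0

end ExtVanishing

/-! ### Prolonging a sequence by a polynomial in a new variable -/

section GenericPolynomial

open Polynomial RingTheory.Sequence

variable {S : Type*} [CommRing S]

/-- McCoy's theorem modulo the extension of an ideal of the coefficient ring. -/
lemma Polynomial.mem_map_C_of_mul_mem_map_C {L : Ideal S} {p q : S[X]}
    (hp : ∀ s, (∀ i, s * p.coeff i ∈ L) → s ∈ L) (hpq : p * q ∈ L.map C) : q ∈ L.map C := by
  have key (r : S[X]) : r ∈ L.map C ↔ r.map (Ideal.Quotient.mk L) = 0 := by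
    simp [Ideal.mem_map_C_iff, Polynomial.ext_iff, Ideal.Quotient.eq_zero_iff_mem]
  rw [key] at hpq ⊢
  have hreg : p.map (Ideal.Quotient.mk L) ∈ nonZeroDivisors (S ⧸ L)[X] := by
    -- McCoy: only constant annihilators need to be tested.
    rw [Polynomial.mem_nonZeroDivisors_iff]
    intro a ha
    obtain ⟨s, rfl⟩ := Ideal.Quotient.mk_surjective a
    rw [Ideal.Quotient.eq_zero_iff_mem]
    refine hp s fun i ↦ ?_
    have := congrArg (fun r ↦ r.coeff i) ha
    simpa [← map_mul, Ideal.Quotient.eq_zero_iff_mem] using this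
  rw [Polynomial.map_mul, mul_comm] at hpq
  exact (mem_nonZeroDivisors_iff.mp hreg).2 _ hpq

lemma Polynomial.exists_span_range_coeff_eq {K : Ideal S} (hK : K.FG) :
    ∃ p : S[X], Ideal.span (Set.range p.coeff) = K := by
  obtain ⟨n, c, rfl⟩ := Submodule.fg_iff_exists_fin_generating_family.mp hK
  refine ⟨∑ i : Fin n, monomial i (c i), le_antisymm (Ideal.span_le.mpr ?_) ?_⟩
  · rintro _ ⟨j, rfl⟩
    rw [finsetSum_coeff]
    refine Ideal.sum_mem _ fun i _ ↦ ?_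
    rw [coeff_monomial]
    split_ifs
    · exact Submodule.subset_span ⟨i, rfl⟩
    · exact zero_mem _
  · refine Submodule.span_le.mpr ?_
    rintro _ ⟨j, rfl⟩
    refine Ideal.subset_span ⟨j, ?_⟩
    simp [coeff_monomial, Fin.val_inj]

lemma Ideal.fg_ofList (rs : List S) : (Ideal.ofList rs).FG := by
  classical exact ⟨rs.toFinset, by simp [Ideal.ofList, Ideal.span]⟩

/-- If `I` and `J` contain weakly regular sequences longer than a weakly regular sequence `fs`,
then `fs` can be prolonged by an element of the extension of `I * J` to `S[X]`. -/
lemma exists_isWeaklyRegular_append_polynomial {I J : Ideal S} {as bs fs : List S}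
    (has : ∀ a ∈ as, a ∈ I) (ras : IsWeaklyRegular S as)
    (hbs : ∀ b ∈ bs, b ∈ J) (rbs : IsWeaklyRegular S bs) (rfs : IsWeaklyRegular S fs)
    (hla : fs.length < as.length) (hlb : fs.length < bs.length) :
    ∃ p ∈ (I * J).map C, IsWeaklyRegular S[X] (fs.map C ++ [p]) := by
  -- `I * J` need not be finitely generated; the ideals generated by `as` and `bs` suffice.
  obtain ⟨p, hp⟩ := Polynomial.exists_span_range_coeff_eq
    ((Ideal.fg_ofList as).mul (Ideal.fg_ofList bs))
  have hIJ : Ideal.ofList as * Ideal.ofList bs ≤ I * J :=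
    Ideal.mul_mono (Ideal.span_le.mpr has) (Ideal.span_le.mpr hbs)
  refine ⟨p, Ideal.mem_map_C_iff.mpr fun i ↦ hIJ ?_, ?_⟩
  · rw [← hp]
    exact Ideal.subset_span ⟨i, rfl⟩
  rw [isWeaklyRegular_append_iff, isWeaklyRegular_singleton_iff]
  refine ⟨rfs.of_flat (S := S[X]), ?_⟩
  rw [isSMulRegular_iff_right_eq_zero_of_smul]
  intro q
  obtain ⟨q, rfl⟩ := Submodule.Quotient.mk_surjective _ q
  rw [← Submodule.Quotient.mk_smul, Submodule.Quotient.mk_eq_zero, Submodule.Quotient.mk_eq_zero]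
  simp only [smul_eq_mul, Ideal.mul_top, ← Ideal.map_ofList]
  refine Polynomial.mem_map_C_of_mul_mem_map_C fun s hs ↦ ?_
  have hs' : ∀ c ∈ Ideal.ofList as * Ideal.ofList bs, s * c ∈ Ideal.ofList fs := by
    rw [← hp]
    intro c hc
    refine Submodule.span_induction (p := fun c _ ↦ s * c ∈ Ideal.ofList fs) ?_ (by simp)
      (fun x y _ _ hx hy ↦ by rw [mul_add]; exact add_mem hx hy)
      (fun a x _ hx ↦ by rw [smul_eq_mul, mul_left_comm]; exact Ideal.mul_mem_left _ _ hx) hc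
    rintro _ ⟨i, rfl⟩
    exact hs i
  -- The colon property is used for `as` on `s`, then for `bs` on each `a * s`.
  refine mem_ofList_of_forall_mul_mem_ofList (I := Ideal.ofList as)
    (fun a ha ↦ Ideal.subset_span ha) ras rfs hla fun a ha ↦ ?_
  refine mem_ofList_of_forall_mul_mem_ofList (I := Ideal.ofList bs)
    (fun b hb ↦ Ideal.subset_span hb) rbs rfs hlb fun b hb ↦ ?_
  convert hs' (a * b) (Ideal.mul_mem_mul ha hb) using 1
  ring

end GenericPolynomial

/-! ### Grade, polynomial grade and the valuation axioms -/

section Grade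

open RingTheory.Sequence

variable {R : Type*} [CommRing R]

lemma RingTheory.Sequence.IsWeaklyRegular.take {rs : List R} (h : IsWeaklyRegular R rs) (k : ℕ) :
    IsWeaklyRegular R (rs.take k) := by
  rw [← List.take_append_drop k rs, isWeaklyRegular_append_iff] at h
  exact h.1

lemma RingTheory.Sequence.IsWeaklyRegular.map_ringEquiv {S : Type*} [CommRing S] (e : R ≃+* S)
    {rs : List R} (h : IsWeaklyRegular R rs) : IsWeaklyRegular S (rs.map e) := by
  refine (AddEquiv.isWeaklyRegular_congr (e := e.toAddEquiv) (as := rs) (bs := rs.map e) ?_).mp h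
  rw [List.forall₂_map_right_iff, List.forall₂_same]
  exact fun r _ x ↦ map_mul e r x

/-- Prefixes of weakly regular sequences are weakly regular, so every finite length up to the
supremum is attained. -/
lemma natCast_le_classicalGrade_iff {I : Ideal R} {n : ℕ} :
    (n : ℕ∞) ≤ classicalGrade I ↔
      ∃ a : List R, (∀ x ∈ a, x ∈ I) ∧ IsWeaklyRegular R a ∧ a.length = n := by
  constructor
  · intro h
    cases n with
    | zero => exact ⟨[], by simp, .nil R R, rfl⟩
    | succ n =>
      have hlt : (n : ℕ∞) < classicalGrade I :=
        lt_of_lt_of_le (by exact_mod_cast n.lt_succ_self) h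
      obtain ⟨_, ⟨a, ha, hreg, rfl⟩, hn⟩ := lt_sSup_iff.mp hlt
      refine ⟨a.take (n + 1), fun x hx ↦ ha x (List.mem_of_mem_take hx), hreg.take _, ?_⟩
      have : n < a.length := by exact_mod_cast hn
      simpa using this
  · rintro ⟨a, ha, hreg, rfl⟩
    exact le_sSup ⟨a, ha, hreg, rfl⟩

lemma classicalGrade_mono {I J : Ideal R} (h : I ≤ J) : classicalGrade I ≤ classicalGrade J :=
  sSup_le_sSup fun _ ⟨a, ha, hreg, hn⟩ ↦ ⟨a, fun x hx ↦ h (ha x hx), hreg, hn⟩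

lemma gradeInVariables_mono {I J : Ideal R} (h : I ≤ J) (m : ℕ) :
    gradeInVariables I m ≤ gradeInVariables J m :=
  classicalGrade_mono (Ideal.map_mono h)

lemma classicalGrade_le_classicalGrade_map {S : Type*} [CommRing S] [Algebra R S]
    [Module.Flat R S] (I : Ideal R) :
    classicalGrade I ≤ classicalGrade (I.map (algebraMap R S)) := by
  refine sSup_le ?_
  rintro _ ⟨a, ha, hreg, rfl⟩
  refine le_sSup ⟨a.map (algebraMap R S), ?_, hreg.of_flat, by simp⟩
  simp only [List.mem_map, forall_exists_index, and_imp]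
  rintro _ x hx rfl
  exact Ideal.mem_map_of_mem _ (ha x hx)

lemma classicalGrade_le_classicalGrade_map_ringEquiv {S : Type*} [CommRing S] (e : R ≃+* S)
    (I : Ideal R) : classicalGrade I ≤ classicalGrade (I.map e) := by
  refine sSup_le ?_
  rintro _ ⟨a, ha, hreg, rfl⟩
  refine le_sSup ⟨a.map e, ?_, hreg.map_ringEquiv e, by simp⟩
  simp only [List.mem_map, forall_exists_index, and_imp]
  rintro _ x hx rfl
  exact Ideal.mem_map_of_mem _ (ha x hx)

lemma classicalGrade_map_ringEquiv {S : Type*} [CommRing S] (e : R ≃+* S) (I : Ideal R) :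
    classicalGrade (I.map e) = classicalGrade I := by
  refine le_antisymm ?_ (classicalGrade_le_classicalGrade_map_ringEquiv e I)
  refine (classicalGrade_le_classicalGrade_map_ringEquiv e.symm (I.map e)).trans_eq
    (congrArg classicalGrade ?_)
  rw [Ideal.map_symm, Ideal.comap_map_of_bijective e e.bijective]

/-- Singling out one variable: the grade of `I[X₁, …, Xₘ₊₁]` is that of `I[X₁, …, Xₘ][T]`. -/
lemma gradeInVariables_succ (I : Ideal R) (m : ℕ) :
    gradeInVariables I (m + 1) = classicalGrade
      ((I.map (MvPolynomial.C : R →+* MvPolynomial (Fin m) R)).map Polynomial.C) := by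
  have h : ((MvPolynomial.finSuccEquiv R m).toRingEquiv :
      MvPolynomial (Fin (m + 1)) R →+* _).comp MvPolynomial.C =
        Polynomial.C.comp (MvPolynomial.C : R →+* MvPolynomial (Fin m) R) := by
    ext r
    simp [MvPolynomial.finSuccEquiv_apply]
  rw [gradeInVariables, ← classicalGrade_map_ringEquiv (MvPolynomial.finSuccEquiv R m).toRingEquiv,
    Ideal.map_map, ← h, ← Ideal.map_map]
  rfl

lemma gradeInVariables_monotone (I : Ideal R) : Monotone (gradeInVariables I) := by
  refine monotone_nat_of_le_succ fun m ↦ ?_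
  rw [gradeInVariables_succ]
  exact classicalGrade_le_classicalGrade_map _

/-- If the grades of `I` and `J` in `m` variables are at least `n`, then `k ≤ n` new variables
suffice for a weakly regular sequence of length `k` in the extension of `I * J`. -/
lemma le_gradeInVariables_mul {I J : Ideal R} {m n : ℕ} (hI : (n : ℕ∞) ≤ gradeInVariables I m)
    (hJ : (n : ℕ∞) ≤ gradeInVariables J m) {k : ℕ} (hk : k ≤ n) :
    (k : ℕ∞) ≤ gradeInVariables (I * J) (m + k) := by
  induction k with
  | zero => simp
  | succ k ih =>
    obtain ⟨fs, hfs, rfs, lfs⟩ := natCast_le_classicalGrade_iff.mp (ih (by omega))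
    obtain ⟨as, has, ras, las⟩ := natCast_le_classicalGrade_iff.mp
      (hI.trans (gradeInVariables_monotone I (m.le_add_right k)))
    obtain ⟨bs, hbs, rbs, lbs⟩ := natCast_le_classicalGrade_iff.mp
      (hJ.trans (gradeInVariables_monotone J (m.le_add_right k)))
    obtain ⟨p, hp, hreg⟩ := exists_isWeaklyRegular_append_polynomial has ras hbs rbs rfs
      (by omega) (by omega)
    rw [← add_assoc, gradeInVariables_succ, natCast_le_classicalGrade_iff]
    refine ⟨_, ?_, hreg, by simp [lfs]⟩
    simp only [List.mem_append, List.mem_map, List.mem_singleton]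
    rintro _ (⟨f, hf, rfl⟩ | rfl)
    · exact Ideal.mem_map_of_mem _ (hfs f hf)
    · rwa [Ideal.map_mul]

lemma tendsto_gradeInVariables (I : Ideal R) :
    Tendsto (gradeInVariables I) atTop (𝓝 (polynomialGrade I)) :=
  tendsto_nhds_limUnder ⟨_, tendsto_atTop_iSup (gradeInVariables_monotone I)⟩

lemma polynomialGrade_eq_iSup (I : Ideal R) :
    polynomialGrade I = ⨆ m, gradeInVariables I m :=
  tendsto_nhds_unique (tendsto_gradeInVariables I)
    (tendsto_atTop_iSup (gradeInVariables_monotone I))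

lemma polynomialGrade_mono {I J : Ideal R} (h : I ≤ J) :
    polynomialGrade I ≤ polynomialGrade J := by
  rw [polynomialGrade_eq_iSup, polynomialGrade_eq_iSup]
  exact iSup_mono (gradeInVariables_mono h)

lemma natCast_le_polynomialGrade_iff {I : Ideal R} {n : ℕ} :
    (n : ℕ∞) ≤ polynomialGrade I ↔ ∃ m, (n : ℕ∞) ≤ gradeInVariables I m := by
  rw [polynomialGrade_eq_iSup]
  constructor
  · intro h
    cases n with
    | zero => exact ⟨0, by simp⟩
    | succ n =>
      have hlt : (n : ℕ∞) < ⨆ m, gradeInVariables I m :=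
        lt_of_lt_of_le (by exact_mod_cast n.lt_succ_self) h
      obtain ⟨m, hm⟩ := lt_iSup_iff.mp hlt
      exact ⟨m, by exact_mod_cast Order.add_one_le_of_lt hm⟩
  · rintro ⟨m, hm⟩
    exact hm.trans (le_iSup (gradeInVariables I) m)

lemma min_polynomialGrade_le_polynomialGrade_mul (I J : Ideal R) :
    min (polynomialGrade I) (polynomialGrade J) ≤ polynomialGrade (I * J) := by
  refine ENat.forall_natCast_le_iff_le.mp fun n hn ↦ ?_
  obtain ⟨m₁, h₁⟩ := natCast_le_polynomialGrade_iff.mp (hn.trans (min_le_left _ _))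
  obtain ⟨m₂, h₂⟩ := natCast_le_polynomialGrade_iff.mp (hn.trans (min_le_right _ _))
  exact natCast_le_polynomialGrade_iff.mpr ⟨_, le_gradeInVariables_mul (m := max m₁ m₂)
    (h₁.trans (gradeInVariables_monotone I (le_max_left _ _)))
    (h₂.trans (gradeInVariables_monotone J (le_max_right _ _))) le_rfl⟩

lemma polynomialGrade_top : polynomialGrade (⊤ : Ideal R) = ⊤ := by
  refine top_le_iff.mp (ENat.forall_natCast_le_iff_le.mp fun n _ ↦ ?_)
  refine natCast_le_polynomialGrade_iff.mpr ⟨0, natCast_le_classicalGrade_iff.mpr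
    -- Weak regularity allows zero quotients, so `1` can be repeated.
    ⟨List.replicate n 1, ?_, ?_, by simp⟩⟩
  · simp [Ideal.map_top]
  · rw [isWeaklyRegular_iff]
    intro i hi
    simp [IsSMulRegular.one]

lemma classicalGrade_bot [Nontrivial R] : classicalGrade (⊥ : Ideal R) = 0 := by
  by_contra h
  obtain ⟨a, ha, hreg, hlen⟩ := natCast_le_classicalGrade_iff.mp
    (show ((1 : ℕ) : ℕ∞) ≤ _ by exact_mod_cast Order.one_le_iff_pos.mpr (pos_iff_ne_zero.mpr h))
  obtain ⟨x, rfl⟩ := List.length_eq_one_iff.mp hlen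
  obtain rfl : x = 0 := by simpa using ha
  rw [isWeaklyRegular_singleton_iff] at hreg
  exact IsSMulRegular.not_zero hreg

lemma polynomialGrade_bot [Nontrivial R] : polynomialGrade (⊥ : Ideal R) = 0 := by
  simp [polynomialGrade_eq_iSup, gradeInVariables, Ideal.map_bot, classicalGrade_bot]

/-- Finitely many elements of the extension of `I` to a polynomial ring lie in the extension of
a finitely generated subideal of `I`. -/
lemma Ideal.exists_fg_le_forall_mem_map_C {σ : Type*} {I : Ideal R}
    (a : List (MvPolynomial σ R))
    (ha : ∀ x ∈ a, x ∈ I.map (MvPolynomial.C : R →+* MvPolynomial σ R)) :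
    ∃ J ≤ I, J.FG ∧ ∀ x ∈ a, x ∈ J.map (MvPolynomial.C : R →+* MvPolynomial σ R) := by
  classical
  induction a with
  | nil => exact ⟨⊥, bot_le, Submodule.fg_bot, by simp⟩
  | cons x a ih =>
    simp only [List.mem_cons, forall_eq_or_imp] at ha
    obtain ⟨J, hJI, hJ, hJa⟩ := ih ha.2
    have hx := MvPolynomial.mem_map_C_iff.mp ha.1
    let K : Ideal R := Ideal.span (x.support.image x.coeff)
    have hK (i) : x.coeff i ∈ K := by
      by_cases hi : x.coeff i = 0
      · simp [hi]
      · exact Ideal.subset_span (by simpa using ⟨i, hi, rfl⟩)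
    refine ⟨K ⊔ J, sup_le (Ideal.span_le.mpr ?_) hJI, Submodule.FG.sup ⟨x.support.image x.coeff, rfl⟩ hJ, ?_⟩
    · intro y hy
      obtain ⟨i, -, rfl⟩ := Finset.mem_image.mp (Finset.mem_coe.mp hy)
      exact hx i
    · simp only [List.mem_cons, forall_eq_or_imp]
      exact ⟨MvPolynomial.mem_map_C_iff.mpr fun i ↦ Ideal.mem_sup_left (hK i),
        fun y hy ↦ Ideal.map_mono le_sup_right (hJa y hy)⟩

lemma polynomialGrade_eq_sSup_fg (I : Ideal R) :
    polynomialGrade I =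
      sSup {n : ℕ∞ | ∃ J : Ideal R, J ≤ I ∧ J.FG ∧ n = polynomialGrade J} := by
  refine le_antisymm (ENat.forall_natCast_le_iff_le.mp fun n hn ↦ ?_) (sSup_le ?_)
  · obtain ⟨m, hm⟩ := natCast_le_polynomialGrade_iff.mp hn
    obtain ⟨a, ha, hreg, hlen⟩ := natCast_le_classicalGrade_iff.mp hm
    obtain ⟨J, hJI, hJ, hJa⟩ := Ideal.exists_fg_le_forall_mem_map_C a ha
    refine le_trans ?_ (le_sSup ⟨J, hJI, hJ, rfl⟩)
    exact natCast_le_polynomialGrade_iff.mpr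
      ⟨m, natCast_le_classicalGrade_iff.mpr ⟨a, hJa, hreg, hlen⟩⟩
  · rintro _ ⟨J, hJI, -, rfl⟩
    exact polynomialGrade_mono hJI

end Grade

theorem mainTheorem4 {R : Type*} [CommRing R] [IsDomain R] :
    (∀ I : Ideal R,
      Tendsto (fun m : ℕ => gradeInVariables I m) atTop (𝓝 (polynomialGrade I))) ∧
    IsIdealValuation (fun I : Ideal R => polynomialGrade I) :=
  ⟨tendsto_gradeInVariables,
    { map_bot := polynomialGrade_bot
      map_top := polynomialGrade_top
      min_le_map_mul := min_polynomialGrade_le_polynomialGrade_mul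
      eq_sSup_fg := polynomialGrade_eq_sSup_fg }⟩
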